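/- **Setting.** Let $d,n,p,q$ be integers with $n\ge 1$. The observations are $y_i=F(x_i)+z_i\in\mathbb R^p$, $1\le i\le n$, where $F=\sum_{k=1}^q f_k u_k$; the vectors $u_1,\dots,u_q\in\mathbb R^p$ are orthonormal and $f_1,\dots,f_q\in L^2[0,1]^d$ are pairwise orthogonal. The design points $x_i$ are i.i.d. uniform on $[0,1]^d$, the noise vectors $z_i$ are i.i.d. $\mathcal N(0,\sigma^2 I_p)$, and the noise is independent of the design. Put $U=(u_1\dots u_q)$ and $R_n(G)=\frac1n\sum_{i=1}^n\|F(x_i)-G(x_i)\|^2$. For matrices $U,V\in\mathbb R^{p\times q}$ with orthonormal columns let $\sigma_1\ge\dots\ge\sigma_q$ be the singular values of $U^{\mathsf T}V$, let $\Theta(U,V)=\mathrm{diag}(\arccos\sigma_1,\dots,\arccos\sigma_q)$, and let $\|\sin\Theta(U,V)\|$ be the spectral norm of the matrix obtained by applying the sine to its diagonal entries. *Two-step estimator.* The first step gives a random $\hat U=(\hat u_1\dots\hat u_q)$ with orthonormal columns. The second step is a procedure that, given $x_1,\dots,x_n$, $y_1,\dots,y_n$ and vectors $v_1,\dots,v_q\in\mathbb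 R^p$, returns functions $g_1,\dots,g_q$ on the covariate space (for instance minimizers of $\frac1n\sum_i(v_k^{\mathsf T}y_i-g_k(x_i))^2$ plus a penalty). It is applied to $\hat u_1,\dots,\hat u_q$, its output is denoted $\hat f_1,\dots,\hat f_q$, and $\hat F=\sum_{k=1}^q\hat u_k\hat f_k$. The procedure is *direction invariant* if there is one smoothing procedure $S$ for univariate responses such that, for all $v_1,\dots,v_q$ and all $k$, $g_k$ is the result of applying $S$ to the data $(x_i,v_k^{\mathsf T}y_i)_{1\le i\le n}$. $S$ is a *linear smoother* with matrix $L=L(x_1,\dots,x_n)\in\mathbb R^{n\times n}$ if, for almost every design, its fitted values at $x_1,\dots,x_n$ from univariate responses $Y\in\mathbb R^n$ are $LY$. $L$ *attains the rate* $r\in\mathbb R$ with constant $C_3$ if, with $Y^o_{\cdot k}=(u_k^{\mathsf T}y_1,\dots,u_k^{\mathsf T}y_n)^{\mathsf T}$ and $\hat f^o_k=LY^o_{\cdot k}$, $$\max_{1\le k\le q}E\,\frac1n\sum_{i=1}^n\bigl((\hat f_k^o)_i-f_k(x_i)\bigr)^2\le C_3\,n^{-r}.$$ **Theorem.** For all constants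 $\sigma,C_1,C_2,C_3,A,B$ there are a constant $K$ depending only on them and, for every $A'$, a constant $K'$ depending only on them and $A'$, such that the following holds for all $d,n,p,q,r$ and all $U,f_1,\dots,f_q,\hat U$ and second steps as above. Suppose that $$E\,\|\sin\Theta(\hat U,U)\|^4\le C_1(p/n)^2,$$ that the second step is direction invariant and given by a linear smoother whose matrix $L$ satisfies $\|L\|\le C_2$ (spectral norm, for almost every design) and attains the rate $r$ with constant $C_3$, that $p\le An$, and that $\max_k\|f_k\|_\infty\le B$. Then $$E\,R_n(\hat F)\le K\,q\,n^{-r}\max\bigl\{1,\;p\,n^{-(1-r)}\bigr\}.$$ Consequently, if moreover $p\le A'n^{1-r}$, then $E\,R_n(\hat F)\le K'\,q\,n^{-r}$. -/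

import Mathlib

open MeasureTheory ProbabilityTheory
open scoped ENNReal

namespace PSR

noncomputable section

/-- Expectation of a nonnegative random variable, as an extended nonnegative number (so that it is
meaningful, possibly `∞`, without any integrability assumption). -/
def expect {Ω : Type*} [MeasurableSpace Ω] (P : Measure Ω) (X : Ω → ℝ) : ℝ≥0∞ :=
  ∫⁻ ω, ENNReal.ofReal (X ω) ∂P

/-- The spectral norm (largest singular value) of a real matrix, as the operator norm between
Euclidean spaces. -/
def specNorm {m n : ℕ} (A : Matrix (Fin m) (Fin n) ℝ) : ℝ :=
  ‖(Matrix.toEuclideanLin A).toContinuousLinearMap‖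

/-- The matrix `Uᵀ V` for `U = (u₁ … u_q)` and `V = (v₁ … v_q)` given by their columns. -/
def crossGram {p q : ℕ} (u v : Fin q → EuclideanSpace ℝ (Fin p)) : Matrix (Fin q) (Fin q) ℝ :=
  Matrix.of fun j k => inner ℝ (u j) (v k)

/-- The principal angles `arccos σ₁, …, arccos σ_q`, where `σ₁ ≥ … ≥ σ_q` are the singular values
of `Uᵀ V`. -/
def principalAngle {p q : ℕ} (u v : Fin q → EuclideanSpace ℝ (Fin p)) (k : Fin q) : ℝ :=
  Real.arccos ((Matrix.toEuclideanLin (crossGram u v)).singularValues k)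

/-- The matrix `sin Θ(U, V)`. -/
def sinTheta {p q : ℕ} (u v : Fin q → EuclideanSpace ℝ (Fin p)) : Matrix (Fin q) (Fin q) ℝ :=
  Matrix.diagonal fun k => Real.sin (principalAngle u v k)

/-- The uniform distribution on the unit cube `[0, 1]^d`. -/
def unifCube (d : ℕ) : Measure (Fin d → ℝ) :=
  volume.restrict (Set.Icc 0 1)

/-- The law of `n` independent uniform design points on the unit cube. -/
def designLaw (d n : ℕ) : Measure (Fin n → Fin d → ℝ) :=
  Measure.pi fun _ => unifCube d

/-- The function `x ↦ ∑ₖ gₖ(x) vₖ`. -/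
def combine {d p q : ℕ} (v : Fin q → EuclideanSpace ℝ (Fin p)) (g : Fin q → (Fin d → ℝ) → ℝ) :
    (Fin d → ℝ) → EuclideanSpace ℝ (Fin p) :=
  fun x => ∑ k, g k x • v k

/-- The observations `yᵢ = F(xᵢ) + zᵢ` with `F = ∑ₖ fₖ uₖ`. -/
def response {Ω : Type*} {d n p q : ℕ} (u : Fin q → EuclideanSpace ℝ (Fin p))
    (f : Fin q → (Fin d → ℝ) → ℝ) (x : Fin n → Ω → Fin d → ℝ)
    (z : Fin n → Ω → EuclideanSpace ℝ (Fin p)) (ω : Ω) : Fin n → EuclideanSpace ℝ (Fin p) :=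
  fun i => combine u f (x i ω) + z i ω

/-- Nonparametric principal subspace regression: `uₖ` orthonormal, `fₖ ∈ L²[0,1]^d` pairwise
orthogonal, `xᵢ` i.i.d. uniform on the cube, `zᵢ` i.i.d. `N(0, σ² I_p)`, noise independent of the
design. -/
structure IsModel {Ω : Type*} [MeasurableSpace Ω] {d n p q : ℕ} (P : Measure Ω) (σ : ℝ)
    (u : Fin q → EuclideanSpace ℝ (Fin p)) (f : Fin q → (Fin d → ℝ) → ℝ)
    (x : Fin n → Ω → Fin d → ℝ) (z : Fin n → Ω → EuclideanSpace ℝ (Fin p)) : Prop where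
  orthonormal : Orthonormal ℝ u
  memLp : ∀ k, MemLp (f k) 2 (unifCube d)
  orthogonal : ∀ j k, j ≠ k → ∫ t, f j t * f k t ∂(unifCube d) = 0
  design_law : ∀ i, HasLaw (x i) (unifCube d) P
  design_indep : iIndepFun x P
  noise_law : ∀ i, HasLaw (z i)
    (multivariateGaussian (0 : EuclideanSpace ℝ (Fin p)) (σ ^ 2 • (1 : Matrix (Fin p) (Fin p) ℝ))) P
  noise_indep : iIndepFun z P
  design_noise_indep : IndepFun (fun ω i => x i ω) (fun ω i => z i ω) P

/-- The sample discrepancy `Rₙ(G) = n⁻¹ ∑ᵢ ‖F(xᵢ) - G(xᵢ)‖²`. -/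
def sampleDiscrepancy {d n p : ℕ} (F G : (Fin d → ℝ) → EuclideanSpace ℝ (Fin p))
    (x : Fin n → Fin d → ℝ) : ℝ :=
  (1 / (n : ℝ)) * ∑ i, ‖F (x i) - G (x i)‖ ^ 2

/-- A second step of the estimation procedure: from the design, the responses and a collection of
directions `v₁, …, v_q` it produces functions `f̂₁, …, f̂_q` on the covariate space (such as
minimizers `gₖ` of the empirical criterion `n⁻¹ ∑ᵢ (vₖᵀ yᵢ - gₖ(xᵢ))²` plus a penalty). -/
abbrev SecondStep (d n p q : ℕ) : Type :=
  (Fin n → Fin d → ℝ) → (Fin n → EuclideanSpace ℝ (Fin p)) →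
    (Fin q → EuclideanSpace ℝ (Fin p)) → Fin q → (Fin d → ℝ) → ℝ

/-- A smoothing procedure for univariate responses: from the design and `n` real responses it
produces a function on the covariate space. -/
abbrev Smoother (d n : ℕ) : Type :=
  (Fin n → Fin d → ℝ) → (Fin n → ℝ) → (Fin d → ℝ) → ℝ

/-- Direction invariance: for all directions, the `k`-th estimate is obtained by applying one and
the same smoothing procedure `S` to the projected data `vₖᵀ yᵢ`. -/
def IsDirectionInvariant {d n p q : ℕ} (T : SecondStep d n p q) (S : Smoother d n) : Prop :=
  ∀ x y v k, T x y v k = S x fun i => inner ℝ (v k) (y i)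

/-- `S` is a linear smoother with (design dependent) smoothing matrix `L`: for almost every design,
the fitted values at the design points are `L Y`. -/
structure IsLinearSmoother {d n : ℕ} (S : Smoother d n)
    (L : (Fin n → Fin d → ℝ) → Matrix (Fin n) (Fin n) ℝ) : Prop where
  aemeasurable : ∀ i j, AEMeasurable (fun x => L x i j) (designLaw d n)
  fitted : ∀ᵐ x ∂(designLaw d n), ∀ (Y : Fin n → ℝ) (i : Fin n), S x Y (x i) = (L x).mulVec Y i

/-- `L` attains the rate `r` with constant `C`: with the oracle data `Yᵒᵢₖ = uₖᵀ yᵢ` and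
`f̂ᵒₖ = L Yᵒₖ`, one has `E ‖f̂ᵒₖ - fₖ‖ₙ² ≤ C n⁻ʳ` for every `k`. -/
def AttainsRate {Ω : Type*} [MeasurableSpace Ω] {d n p q : ℕ} (P : Measure Ω)
    (u : Fin q → EuclideanSpace ℝ (Fin p)) (f : Fin q → (Fin d → ℝ) → ℝ)
    (x : Fin n → Ω → Fin d → ℝ) (z : Fin n → Ω → EuclideanSpace ℝ (Fin p))
    (L : (Fin n → Fin d → ℝ) → Matrix (Fin n) (Fin n) ℝ) (C r : ℝ) : Prop :=
  ∀ k, expect P (fun ω => (1 / (n : ℝ)) * ∑ i,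
      ((L fun j => x j ω).mulVec (fun j => inner ℝ (u k) (response u f x z ω j)) i
        - f k (x i ω)) ^ 2)
    ≤ ENNReal.ofReal (C * (n : ℝ) ^ (-r))

/-- The two-step estimator `F̂ = ∑ₖ ûₖ f̂ₖ`, where `f̂₁, …, f̂_q` come from the second step applied
along the estimated directions `û₁, …, û_q`. -/
def twoStep {d n p q : ℕ} (T : SecondStep d n p q) (x : Fin n → Fin d → ℝ)
    (y : Fin n → EuclideanSpace ℝ (Fin p)) (uhat : Fin q → EuclideanSpace ℝ (Fin p)) :
    (Fin d → ℝ) → EuclideanSpace ℝ (Fin p) :=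
  combine uhat (T x y uhat)

end

end PSR

/-!
Write `P = U Uᵀ` and `P̂ = Û Ûᵀ` for the two projections, `Y = F + Z` for the `n × p` matrix of the
responses. Because the second step is direction invariant and linear, its fitted values are the rows
of `L Y P̂`, whatever basis of the estimated subspace is used, and the error splits as
`L Y P̂ - F = (L Y P - F) + L Y (P̂ - P)`.

The first part is the oracle error, at most `C₃ q n⁻ʳ` by assumption. The second part is at most
`‖L‖` times the Frobenius norm of `F (P̂ - P) + Z (P̂ - P)`. The rows of `F` lie in the span of `U`,
where `P̂ - P` is bounded by `‖sin Θ‖` (`norm_frameProj_sub_sq_le`), so the signal contributes at most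
`q B² ‖sin Θ‖²` to the sample average. The estimated directions may depend on the noise, so for `Z`
only `‖Z (P̂ - P)‖_F² ≤ ‖Z‖² ‖P̂ - P‖_F²` is available, and `‖P̂ - P‖_F² ≤ 2 q ‖sin Θ‖²`
(`sum_norm_frameProj_sub_sq_le`); both follow from the fact that the singular values of `Ûᵀ U` are
at least `√(1 - ‖sin Θ‖²)`. These bounds are combined in `sampleDiscrepancy_twoStep_le`.

In expectation, `‖sin Θ‖²` is of order `p / n` in mean square by assumption, and `‖Z‖² / n` is of
order one in mean square because `p ≤ A n` (`lintegral_opNorm_rowMap_pow_four_le`). The latter is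
proved through the exponential moment of `‖Z‖²`: a ball of directions near the maximizing one
carries at least half of the norm, so `exp (c ‖Z‖² / 4)` is at most `5 ^ p` times an average of
`exp (c ‖Z b‖²)` over a ball of fixed `b`, and the mean of the latter is at most `√2 ^ n`. Thus the
rotation error is of order `q p / n`, and `max {n⁻ʳ, p / n} = n⁻ʳ max {1, p n^{-(1-r)}}`.
-/

namespace PSR

/-! ### The operator norm of a Gaussian matrix -/

open scoped NNReal

/-- Exponential square integrability: multiplied by `exp (t² / (4v))`, the density of `N(0, v)` is
`√2` times the density of `N(0, 2v)`. -/
lemma lintegral_exp_sq_gaussianReal_le (v : ℝ≥0) (c : ℝ) (hc : c * v ≤ 1 / 4) :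
    ∫⁻ t, ENNReal.ofReal (Real.exp (c * t ^ 2)) ∂(gaussianReal 0 v) ≤ ENNReal.ofReal (√2) := by
  rcases eq_or_ne v 0 with rfl | hv
  · simp only [gaussianReal_zero_var, lintegral_dirac]
    simp
  have hv' : (0 : ℝ) < v := by positivity
  have h2v : 2 * v ≠ 0 := by positivity
  rw [gaussianReal_of_var_ne_zero _ hv,
    lintegral_withDensity_eq_lintegral_mul _ (measurable_gaussianPDF 0 v) (by fun_prop)]
  calc ∫⁻ t, (gaussianPDF 0 v * fun t => ENNReal.ofReal (Real.exp (c * t ^ 2))) t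
      ≤ ∫⁻ t, ENNReal.ofReal (√2) * ENNReal.ofReal (gaussianPDFReal 0 (2 * v) t) := by
        refine lintegral_mono fun t => ?_
        simp only [Pi.mul_apply, gaussianPDF]
        rw [← ENNReal.ofReal_mul (gaussianPDFReal_nonneg _ _ _),
          ← ENNReal.ofReal_mul (Real.sqrt_nonneg _)]
        refine ENNReal.ofReal_le_ofReal ?_
        have hct : c * t ^ 2 ≤ t ^ 2 / (4 * v) := by
          have : c ≤ 1 / (4 * v) := by
            rw [le_div_iff₀ (by positivity)]; linarith
          calc c * t ^ 2 ≤ 1 / (4 * v) * t ^ 2 := by gcongr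
            _ = _ := by ring
        calc gaussianPDFReal 0 v t * Real.exp (c * t ^ 2)
            ≤ gaussianPDFReal 0 v t * Real.exp (t ^ 2 / (4 * v)) := by
              gcongr; exact gaussianPDFReal_nonneg _ _ _
          _ = √2 * gaussianPDFReal 0 (2 * v) t := by
              simp only [gaussianPDFReal, NNReal.coe_mul, NNReal.coe_ofNat, sub_zero]
              have e1 : √(2 * Real.pi * (2 * v)) = √2 * √(2 * Real.pi * v) := by
                rw [← Real.sqrt_mul (by norm_num)]; congr 1; ring
              have e2 : Real.exp (-t ^ 2 / (2 * (2 * v)))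
                  = Real.exp (-t ^ 2 / (2 * v)) * Real.exp (t ^ 2 / (4 * v)) := by
                rw [← Real.exp_add]; congr 1; field_simp; ring
              rw [e1, e2, mul_inv]
              have : √(2 : ℝ) ≠ 0 := by positivity
              field_simp
    _ = ENNReal.ofReal (√2) := by
        rw [lintegral_const_mul' _ _ ENNReal.ofReal_ne_top, lintegral_gaussianPDFReal_eq_one 0 h2v,
          mul_one]

lemma map_inner_isotropicGaussian {p : ℕ} (σ : ℝ) (b : EuclideanSpace ℝ (Fin p)) :
    (multivariateGaussian (0 : EuclideanSpace ℝ (Fin p))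
      (σ ^ 2 • (1 : Matrix (Fin p) (Fin p) ℝ))).map (fun z => inner ℝ z b)
      = gaussianReal 0 (σ ^ 2 * ‖b‖ ^ 2).toNNReal := by
  have hS : (σ ^ 2 • (1 : Matrix (Fin p) (Fin p) ℝ)).PosSemidef :=
    Matrix.PosSemidef.one.smul (sq_nonneg σ)
  have h := IsGaussian.map_eq_gaussianReal (μ := multivariateGaussian
    (0 : EuclideanSpace ℝ (Fin p)) (σ ^ 2 • (1 : Matrix (Fin p) (Fin p) ℝ))) (innerSL ℝ b)
  have hv : Var[innerSL ℝ b; multivariateGaussian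
    (0 : EuclideanSpace ℝ (Fin p)) (σ ^ 2 • (1 : Matrix (Fin p) (Fin p) ℝ))]
      = σ ^ 2 * ‖b‖ ^ 2 := by
    have := covarianceBilin_multivariateGaussian (μ := 0) hS b b
    rw [covarianceBilin_self IsGaussian.memLp_two_id] at this
    refine Eq.trans this ?_
    rw [EuclideanSpace.norm_sq_eq, Matrix.smul_mulVec, Matrix.one_mulVec, dotProduct_smul]
    simp [dotProduct, sq]
  rw [hv] at h
  rw [ContinuousLinearMap.integral_comp_id_comm IsGaussian.integrable_id,
    integral_id_multivariateGaussian, map_zero] at h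
  rw [← h]
  congr 1
  ext z
  simp [real_inner_comm]

lemma lintegral_exp_inner_sq_le {p : ℕ} (σ c : ℝ) (b : EuclideanSpace ℝ (Fin p))
    (hc : c * (σ ^ 2 * ‖b‖ ^ 2) ≤ 1 / 4) :
    ∫⁻ z, ENNReal.ofReal (Real.exp (c * (inner ℝ z b) ^ 2)) ∂(multivariateGaussian
      (0 : EuclideanSpace ℝ (Fin p)) (σ ^ 2 • (1 : Matrix (Fin p) (Fin p) ℝ)))
      ≤ ENNReal.ofReal (√2) := by
  refine le_trans (le_of_eq ?_) (lintegral_exp_sq_gaussianReal_le (σ ^ 2 * ‖b‖ ^ 2).toNNReal c ?_)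
  · rw [← map_inner_isotropicGaussian, lintegral_map (by fun_prop) (by fun_prop)]
  · rwa [Real.coe_toNNReal _ (by positivity)]

lemma lintegral_exp_sum_inner_sq_le {n p : ℕ} (σ c : ℝ) (b : EuclideanSpace ℝ (Fin p))
    (hc : c * (σ ^ 2 * ‖b‖ ^ 2) ≤ 1 / 4) :
    ∫⁻ z, ENNReal.ofReal (Real.exp (c * ∑ i, (inner ℝ (z i) b) ^ 2))
      ∂(Measure.pi fun _ : Fin n => multivariateGaussian
        (0 : EuclideanSpace ℝ (Fin p)) (σ ^ 2 • (1 : Matrix (Fin p) (Fin p) ℝ)))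
      ≤ ENNReal.ofReal (√2) ^ n := by
  set γ := multivariateGaussian
        (0 : EuclideanSpace ℝ (Fin p)) (σ ^ 2 • (1 : Matrix (Fin p) (Fin p) ℝ)) with hγ
  have hm : Measurable fun z : EuclideanSpace ℝ (Fin p) =>
      ENNReal.ofReal (Real.exp (c * (inner ℝ z b) ^ 2)) := by fun_prop
  have hprod : ∀ z : Fin n → EuclideanSpace ℝ (Fin p),
      ENNReal.ofReal (Real.exp (c * ∑ i, (inner ℝ (z i) b) ^ 2))
      = ∏ i, ENNReal.ofReal (Real.exp (c * (inner ℝ (z i) b) ^ 2)) := fun z => by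
    rw [Finset.mul_sum, Real.exp_sum, ENNReal.ofReal_prod_of_nonneg fun _ _ => (Real.exp_pos _).le]
  simp_rw [hprod]
  have hind := iIndepFun_pi (μ := fun _ : Fin n => γ)
    (X := fun _ z => ENNReal.ofReal (Real.exp (c * (inner ℝ z b) ^ 2))) fun _ => hm.aemeasurable
  rw [lintegral_prod_eq_prod_lintegral_of_indepFun Finset.univ _ hind
    fun i => hm.comp (measurable_pi_apply i)]
  calc _ ≤ ∏ _i : Fin n, ENNReal.ofReal (√2) := by
        refine Finset.prod_le_prod' fun i _ => ?_
        rw [(measurePreserving_eval (fun _ : Fin n => γ) i).lintegral_comp hm]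
        exact lintegral_exp_inner_sq_le σ c b hc
    _ = _ := by simp

/-- A volume argument in place of an `ε`-net: on a ball of radius `1/4` around a point of the unit
ball where `T` nearly attains its norm, `‖T b‖ ≥ ‖T‖ / 2`. -/
lemma exp_opNorm_sq_mul_volume_le {E F : Type*} [NormedAddCommGroup E] [NormedSpace ℝ E]
    [MeasurableSpace E] [BorelSpace E] [NormedAddCommGroup F] [NormedSpace ℝ F]
    (μ : Measure E) [μ.IsAddLeftInvariant] (T : E →L[ℝ] F) {c : ℝ} (hc : 0 ≤ c) :
    ENNReal.ofReal (Real.exp (c * ‖T‖ ^ 2 / 4)) * μ (Metric.ball 0 (1 / 4))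
      ≤ ∫⁻ b in Metric.ball 0 (5 / 4), ENNReal.ofReal (Real.exp (c * ‖T b‖ ^ 2)) ∂μ := by
  obtain ⟨b₀, hb₀, hTb₀⟩ : ∃ b₀ : E, ‖b₀‖ ≤ 1 ∧ 3 / 4 * ‖T‖ ≤ ‖T b₀‖ := by
    rcases (norm_nonneg T).eq_or_lt with h | h
    · exact ⟨0, by simp, by simp [← h]⟩
    · obtain ⟨b₀, h1, h2⟩ := T.exists_lt_apply_of_lt_opNorm (r := 3 / 4 * ‖T‖) (by linarith)
      exact ⟨b₀, h1.le, h2.le⟩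
  have hvol : μ (Metric.ball b₀ (1 / 4)) = μ (Metric.ball 0 (1 / 4)) := by
    rw [← measure_preimage_add μ b₀ (Metric.ball b₀ (1 / 4))]
    congr 1
    ext y; simp
  have hsub : Metric.ball b₀ (1 / 4) ⊆ Metric.ball (0 : E) (5 / 4) :=
    Metric.ball_subset_ball' (by rw [dist_zero_right]; linarith)
  calc _ = ∫⁻ _b in Metric.ball b₀ (1 / 4), ENNReal.ofReal (Real.exp (c * ‖T‖ ^ 2 / 4)) ∂μ := by
        rw [setLIntegral_const, hvol]
    _ ≤ ∫⁻ b in Metric.ball b₀ (1 / 4), ENNReal.ofReal (Real.exp (c * ‖T b‖ ^ 2)) ∂μ := by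
        refine setLIntegral_mono' Metric.isOpen_ball.measurableSet fun b hb => ?_
        refine ENNReal.ofReal_le_ofReal (Real.exp_le_exp.2 ?_)
        have hd : ‖T b₀‖ - ‖T b‖ ≤ ‖T‖ * (1 / 4) := by
          calc ‖T b₀‖ - ‖T b‖ ≤ ‖T b₀ - T b‖ := norm_sub_norm_le _ _
            _ = ‖T (b₀ - b)‖ := by rw [map_sub]
            _ ≤ ‖T‖ * ‖b₀ - b‖ := T.le_opNorm _
            _ ≤ ‖T‖ * (1 / 4) := by
              gcongr; rw [← dist_eq_norm, dist_comm]; exact (Metric.mem_ball.1 hb).le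
        have h2 : ‖T‖ / 2 ≤ ‖T b‖ := by linarith
        calc c * ‖T‖ ^ 2 / 4 = c * (‖T‖ / 2) ^ 2 := by ring
          _ ≤ c * ‖T b‖ ^ 2 := by gcongr
    _ ≤ _ := lintegral_mono_set hsub

/-- The linear map `b ↦ (⟪w₁, b⟫, …, ⟪w_n, b⟫)`, given by the matrix with rows `w₁, …, w_n`. -/
noncomputable def rowMap {n p : ℕ} (w : Fin n → EuclideanSpace ℝ (Fin p)) :
    EuclideanSpace ℝ (Fin p) →L[ℝ] EuclideanSpace ℝ (Fin n) :=
  ∑ i, (innerSL ℝ (w i)).smulRight (EuclideanSpace.single i 1)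

lemma norm_rowMap_apply_sq {n p : ℕ} (w : Fin n → EuclideanSpace ℝ (Fin p))
    (b : EuclideanSpace ℝ (Fin p)) : ‖rowMap w b‖ ^ 2 = ∑ i, (inner ℝ (w i) b) ^ 2 := by
  rw [EuclideanSpace.norm_sq_eq]
  refine Finset.sum_congr rfl fun i _ => ?_
  simp [rowMap, Pi.single_apply]

lemma continuous_rowMap {n p : ℕ} :
    Continuous (rowMap : (Fin n → EuclideanSpace ℝ (Fin p)) → _) := by
  unfold rowMap
  refine continuous_finsetSum _ fun i _ => ?_
  exact ((ContinuousLinearMap.smulRightL ℝ (EuclideanSpace ℝ (Fin p))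
    (EuclideanSpace ℝ (Fin n))).flip _).continuous.comp
      ((innerSL ℝ).continuous.comp (continuous_apply i))

/-- The volume bound and Tonelli's theorem reduce the exponential moment of the operator norm of the
Gaussian matrix to that of its action on fixed vectors; `5 ^ p` is the ratio of the volumes. -/
lemma lintegral_exp_opNorm_rowMap_le {n p : ℕ} (σ : ℝ) {c : ℝ} (hc : 0 ≤ c)
    (hcσ : c * σ ^ 2 ≤ 4 / 25) :
    ∫⁻ z, ENNReal.ofReal (Real.exp (c * ‖rowMap z‖ ^ 2 / 4))
      ∂(Measure.pi fun _ : Fin n => multivariateGaussian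
        (0 : EuclideanSpace ℝ (Fin p)) (σ ^ 2 • (1 : Matrix (Fin p) (Fin p) ℝ)))
      ≤ 5 ^ p * ENNReal.ofReal (√2) ^ n := by
  set Γ := Measure.pi fun _ : Fin n => multivariateGaussian
        (0 : EuclideanSpace ℝ (Fin p)) (σ ^ 2 • (1 : Matrix (Fin p) (Fin p) ℝ))
  let μ : Measure (EuclideanSpace ℝ (Fin p)) := volume
  set m := μ (Metric.ball 0 (1 / 4)) with hm
  have hm0 : m ≠ 0 := (Metric.measure_ball_pos μ _ (by norm_num)).ne'
  have hmt : m ≠ ∞ := measure_ball_lt_top.ne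
  have hball : μ (Metric.ball 0 (5 / 4)) = 5 ^ p * m := by
    have := Measure.addHaar_ball_mul_of_pos μ (0 : EuclideanSpace ℝ (Fin p))
      (r := 5) (by norm_num) (1 / 4)
    rw [show (5 : ℝ) * (1 / 4) = 5 / 4 by norm_num] at this
    rw [this, finrank_euclideanSpace_fin, ENNReal.ofReal_pow (by norm_num)]
    norm_num [hm]
  rw [← ENNReal.mul_le_mul_iff_left hm0 hmt]
  calc (∫⁻ z, ENNReal.ofReal (Real.exp (c * ‖rowMap z‖ ^ 2 / 4)) ∂Γ) * m
      = ∫⁻ z, ENNReal.ofReal (Real.exp (c * ‖rowMap z‖ ^ 2 / 4)) * m ∂Γ :=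
        (lintegral_mul_const' _ _ hmt).symm
    _ ≤ ∫⁻ z, ∫⁻ b in Metric.ball 0 (5 / 4),
          ENNReal.ofReal (Real.exp (c * ∑ i, (inner ℝ (z i) b) ^ 2)) ∂μ ∂Γ := by
        refine lintegral_mono fun z => ?_
        simp_rw [← norm_rowMap_apply_sq]
        exact exp_opNorm_sq_mul_volume_le μ (rowMap z) hc
    _ = ∫⁻ b in Metric.ball 0 (5 / 4), ∫⁻ z,
          ENNReal.ofReal (Real.exp (c * ∑ i, (inner ℝ (z i) b) ^ 2)) ∂Γ ∂μ := by
        refine lintegral_lintegral_swap (Measurable.aemeasurable ?_)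
        unfold Function.uncurry
        fun_prop
    _ ≤ ∫⁻ _b in Metric.ball 0 (5 / 4), ENNReal.ofReal (√2) ^ n ∂μ := by
        refine setLIntegral_mono' Metric.isOpen_ball.measurableSet fun b hb => ?_
        refine lintegral_exp_sum_inner_sq_le σ c b ?_
        have hb' : ‖b‖ ≤ 5 / 4 := by simpa using (Metric.mem_ball.1 hb).le
        calc c * (σ ^ 2 * ‖b‖ ^ 2) = c * σ ^ 2 * ‖b‖ ^ 2 := by ring
          _ ≤ 4 / 25 * (5 / 4) ^ 2 := by gcongr
          _ ≤ 1 / 4 := by norm_num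
    _ = 5 ^ p * ENNReal.ofReal (√2) ^ n * m := by
        rw [setLIntegral_const, hball]; ring

lemma sq_le_two_mul_sq_add_exp {w a : ℝ} (hw : 0 ≤ w) (ha : 0 ≤ a) :
    w ^ 2 ≤ 2 * a ^ 2 + 4 * Real.exp (-a) * Real.exp w := by
  rw [mul_assoc, ← Real.exp_add]
  rcases le_total w a with h | h
  · nlinarith [Real.exp_pos (-a + w)]
  · have := Real.quadratic_le_exp_of_nonneg (x := -a + w) (by linarith)
    nlinarith [sq_nonneg (w - 2 * a)]

/-- The fourth moment of the operator norm of an `n × p` Gaussian matrix is of order `(n + p)²`. -/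
lemma lintegral_opNorm_rowMap_pow_four_le {n p : ℕ} (σ : ℝ) {c : ℝ} (hc : 0 ≤ c)
    (hcσ : c * σ ^ 2 ≤ 4 / 25) :
    ∫⁻ z, ENNReal.ofReal ((c * ‖rowMap z‖ ^ 2 / 4) ^ 2)
      ∂(Measure.pi fun _ : Fin n => multivariateGaussian
        (0 : EuclideanSpace ℝ (Fin p)) (σ ^ 2 • (1 : Matrix (Fin p) (Fin p) ℝ)))
      ≤ ENNReal.ofReal (8 * ((n : ℝ) + p) ^ 2 + 4) := by
  set Γ := Measure.pi fun _ : Fin n => multivariateGaussian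
        (0 : EuclideanSpace ℝ (Fin p)) (σ ^ 2 • (1 : Matrix (Fin p) (Fin p) ℝ))
  -- `exp a` bounds the exponential moment, since `√2` and `5` are at most `exp 2`.
  set a : ℝ := 2 * ((n : ℝ) + p) with ha
  have ha0 : 0 ≤ a := by positivity
  have h5 : (5 : ℝ) ≤ Real.exp 2 := by
    have := Real.exp_one_gt_d9
    have h : Real.exp 2 = Real.exp 1 * Real.exp 1 := by rw [← Real.exp_add]; norm_num
    nlinarith
  have hs2 : √2 ≤ Real.exp 2 := by
    have : √2 ≤ 5 := Real.sqrt_le_iff.2 ⟨by norm_num, by norm_num⟩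
    linarith
  have hexp : 5 ^ p * ENNReal.ofReal (√2) ^ n ≤ ENNReal.ofReal (Real.exp a) := by
    rw [← ENNReal.ofReal_pow (by positivity), show (5 : ℝ≥0∞) = ENNReal.ofReal 5 by norm_num,
      ← ENNReal.ofReal_pow (by norm_num), ← ENNReal.ofReal_mul (by positivity)]
    refine ENNReal.ofReal_le_ofReal ?_
    calc (5 : ℝ) ^ p * √2 ^ n ≤ Real.exp 2 ^ p * Real.exp 2 ^ n := by gcongr
      _ = Real.exp a := by
        rw [← Real.exp_nat_mul, ← Real.exp_nat_mul, ← Real.exp_add, ha]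
        congr 1; ring
  calc ∫⁻ z, ENNReal.ofReal ((c * ‖rowMap z‖ ^ 2 / 4) ^ 2) ∂Γ
      ≤ ∫⁻ z, (ENNReal.ofReal (2 * a ^ 2) + ENNReal.ofReal (4 * Real.exp (-a)) *
          ENNReal.ofReal (Real.exp (c * ‖rowMap z‖ ^ 2 / 4))) ∂Γ := by
        refine lintegral_mono fun z => ?_
        rw [← ENNReal.ofReal_mul (by positivity), ← ENNReal.ofReal_add (by positivity)
          (by positivity)]
        exact ENNReal.ofReal_le_ofReal (sq_le_two_mul_sq_add_exp (by positivity) ha0)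
    _ ≤ ENNReal.ofReal (2 * a ^ 2) + ENNReal.ofReal (4 * Real.exp (-a)) *
          ENNReal.ofReal (Real.exp a) := by
        rw [lintegral_add_left measurable_const, lintegral_const_mul' _ _ ENNReal.ofReal_ne_top,
          lintegral_const, measure_univ, mul_one]
        gcongr
        exact (lintegral_exp_opNorm_rowMap_le σ hc hcσ).trans hexp
    _ = ENNReal.ofReal (8 * ((n : ℝ) + p) ^ 2 + 4) := by
        rw [← ENNReal.ofReal_mul (by positivity), ← ENNReal.ofReal_add (by positivity)
          (by positivity), mul_assoc, ← Real.exp_add]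
        congr 1
        rw [ha]; simp; ring

/-! ### Principal angles and projections -/

lemma mul_norm_sq_le_of_le_singularValues {q : ℕ}
    (T : EuclideanSpace ℝ (Fin q) →ₗ[ℝ] EuclideanSpace ℝ (Fin q)) {c : ℝ}
    (h : ∀ k : Fin q, c ≤ T.singularValues k ^ 2) (a : EuclideanSpace ℝ (Fin q)) :
    c * ‖a‖ ^ 2 ≤ ‖T a‖ ^ 2 := by
  have hn : Module.finrank ℝ (EuclideanSpace ℝ (Fin q)) = q := finrank_euclideanSpace_fin
  have hT := T.isSymmetric_adjoint_comp_self
  set b := hT.eigenvectorBasis hn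
  calc c * ‖a‖ ^ 2 = ∑ k : Fin q, c * inner ℝ (b k) a ^ 2 := by
        rw [← b.sum_sq_inner_right a, Finset.mul_sum]
    _ ≤ ∑ k : Fin q, T.singularValues k ^ 2 * inner ℝ (b k) a ^ 2 := by
        gcongr with k; exact h k
    _ = ∑ k : Fin q, inner ℝ a (b k) * inner ℝ (b k) ((T.adjoint ∘ₗ T) a) := by
        refine Finset.sum_congr rfl fun k _ => ?_
        rw [← hT (b k) a, hT.apply_eigenvectorBasis hn k, T.sq_singularValues_fin hn k]
        change _ = _ * inner ℝ (_ • b k) a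
        rw [inner_smul_left, real_inner_comm a (b k)]
        simp only [RCLike.ofReal_real_eq_id, id, conj_trivial]
        ring
    _ = inner ℝ a ((T.adjoint ∘ₗ T) a) := b.sum_inner_mul_inner _ _
    _ = ‖T a‖ ^ 2 := by
        rw [LinearMap.comp_apply, LinearMap.adjoint_inner_right, real_inner_self_eq_norm_sq]

lemma norm_toEuclideanLin_le {m n : ℕ} (A : Matrix (Fin m) (Fin n) ℝ) (a : EuclideanSpace ℝ (Fin n)) :
    ‖Matrix.toEuclideanLin A a‖ ≤ specNorm A * ‖a‖ :=
  (Matrix.toEuclideanLin A).toContinuousLinearMap.le_opNorm a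

lemma specNorm_nonneg {m n : ℕ} (A : Matrix (Fin m) (Fin n) ℝ) : 0 ≤ specNorm A := norm_nonneg _

lemma abs_le_specNorm_diagonal {q : ℕ} (t : Fin q → ℝ) (k : Fin q) :
    |t k| ≤ specNorm (Matrix.diagonal t) := by
  have h := norm_toEuclideanLin_le (Matrix.diagonal t) (EuclideanSpace.single k 1)
  have e : Matrix.toEuclideanLin (Matrix.diagonal t) (EuclideanSpace.single k 1)
      = EuclideanSpace.single k (t k) := by
    ext j
    simp [Matrix.toLpLin_apply]
  rw [e] at h
  simpa using h

/-- Every cosine of a principal angle satisfies `σₖ² ≥ 1 - ‖sin Θ‖²`. It is not needed that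
`σₖ ≤ 1`: otherwise the sine of the junk value `arccos σₖ = 0` is still `√(1 - σₖ²) = 0`. -/
lemma one_sub_sq_le_sq_singularValues {p q : ℕ} (v u : Fin q → EuclideanSpace ℝ (Fin p))
    (k : Fin q) :
    1 - specNorm (sinTheta v u) ^ 2
      ≤ (Matrix.toEuclideanLin (crossGram v u)).singularValues k ^ 2 := by
  have h := abs_le_specNorm_diagonal (fun k => Real.sin (principalAngle v u k)) k
  simp only [principalAngle, Real.sin_arccos] at h
  rw [abs_of_nonneg (Real.sqrt_nonneg _)] at h
  have h2 := (Real.sqrt_le_left (specNorm_nonneg _)).1 h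
  unfold sinTheta principalAngle
  simp only [Real.sin_arccos]
  linarith

/-- `‖Vᵀ U a‖² ≥ (1 - ‖sin Θ(V, U)‖²) ‖a‖²`. -/
lemma one_sub_sq_mul_norm_sq_le {p q : ℕ} {v u : Fin q → EuclideanSpace ℝ (Fin p)}
    (a : Fin q → ℝ) :
    (1 - specNorm (sinTheta v u) ^ 2) * ∑ k, a k ^ 2
      ≤ ∑ j, inner ℝ (v j) (∑ k, a k • u k) ^ 2 := by
  have h := mul_norm_sq_le_of_le_singularValues (Matrix.toEuclideanLin (crossGram v u))
    (one_sub_sq_le_sq_singularValues v u) (WithLp.toLp 2 a)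
  rw [EuclideanSpace.norm_sq_eq, EuclideanSpace.norm_sq_eq] at h
  simp only [Real.norm_eq_abs, sq_abs] at h
  refine h.trans (le_of_eq (Finset.sum_congr rfl fun j _ => ?_))
  simp [Matrix.toLpLin_apply, Matrix.mulVec, dotProduct, crossGram, inner_sum, inner_smul_right,
    mul_comm]

/-- The map `x ↦ ∑ₖ ⟪vₖ, x⟫ vₖ`, that is `V Vᵀ`; for orthonormal `v` it is the orthogonal projection
onto the span of `v`. -/
noncomputable def frameProj {E : Type*} [NormedAddCommGroup E] [InnerProductSpace ℝ E] {q : ℕ}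
    (v : Fin q → E) (x : E) : E := ∑ k, inner ℝ (v k) x • v k

section
variable {E : Type*} [NormedAddCommGroup E] [InnerProductSpace ℝ E] {q : ℕ}

lemma norm_sum_smul_sq {v : Fin q → E} (hv : Orthonormal ℝ v) (a : Fin q → ℝ) :
    ‖∑ k, a k • v k‖ ^ 2 = ∑ k, a k ^ 2 := by
  rw [← real_inner_self_eq_norm_sq, hv.inner_sum]
  simp [sq]

lemma inner_frameProj (v : Fin q → E) (x y : E) :
    inner ℝ (frameProj v x) y = ∑ k, inner ℝ (v k) x * inner ℝ (v k) y := by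
  simp [frameProj, sum_inner, inner_smul_left]

lemma frameProj_add (v : Fin q → E) (x y : E) :
    frameProj v (x + y) = frameProj v x + frameProj v y := by
  simp [frameProj, inner_add_right, add_smul, Finset.sum_add_distrib]

lemma frameProj_sum_smul {v : Fin q → E} (hv : Orthonormal ℝ v) (a : Fin q → ℝ) :
    frameProj v (∑ k, a k • v k) = ∑ k, a k • v k := by
  unfold frameProj
  refine Finset.sum_congr rfl fun k _ => ?_
  rw [hv.inner_right_fintype]

lemma norm_frameProj_sq {v : Fin q → E} (hv : Orthonormal ℝ v) (x : E) :
    ‖frameProj v x‖ ^ 2 = ∑ k, inner ℝ (v k) x ^ 2 :=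
  norm_sum_smul_sq hv _

lemma norm_frameProj_sub_self_sq {v : Fin q → E} (hv : Orthonormal ℝ v) (x : E) :
    ‖frameProj v x - x‖ ^ 2 = ‖x‖ ^ 2 - ∑ k, inner ℝ (v k) x ^ 2 := by
  rw [norm_sub_sq_real, norm_frameProj_sq hv, inner_frameProj]
  simp only [← sq]
  ring

lemma inner_frameProj_sub_comm (v u : Fin q → E) (x y : E) :
    inner ℝ (frameProj v x - frameProj u x) y = inner ℝ x (frameProj v y - frameProj u y) := by
  rw [← real_inner_comm x, inner_sub_left, inner_sub_left]
  simp only [inner_frameProj, mul_comm]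

end

/-- On the span of `u` the two projections differ by at most `‖sin Θ‖` in operator norm. -/
lemma norm_frameProj_sub_sq_le {p q : ℕ} {v u : Fin q → EuclideanSpace ℝ (Fin p)}
    (hv : Orthonormal ℝ v) (hu : Orthonormal ℝ u) (a : Fin q → ℝ) :
    ‖frameProj v (∑ k, a k • u k) - frameProj u (∑ k, a k • u k)‖ ^ 2
      ≤ specNorm (sinTheta v u) ^ 2 * ∑ k, a k ^ 2 := by
  rw [frameProj_sum_smul hu, norm_frameProj_sub_self_sq hv, norm_sum_smul_sq hu]
  linarith [one_sub_sq_mul_norm_sq_le (v := v) (u := u) a]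

/-- The squared Frobenius norm of `V Vᵀ - U Uᵀ` is `2 (q - ‖Vᵀ U‖_F²)`, hence at most
`2 q ‖sin Θ‖²`. -/
lemma sum_norm_frameProj_sub_sq_le {p q : ℕ} {v u : Fin q → EuclideanSpace ℝ (Fin p)}
    (hv : Orthonormal ℝ v) (hu : Orthonormal ℝ u)
    (e : OrthonormalBasis (Fin p) ℝ (EuclideanSpace ℝ (Fin p))) :
    ∑ c, ‖frameProj v (e c) - frameProj u (e c)‖ ^ 2
      ≤ 2 * q * specNorm (sinTheta v u) ^ 2 := by
  have hnorm : ∀ w : Fin q → EuclideanSpace ℝ (Fin p), Orthonormal ℝ w →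
      ∑ c, ‖frameProj w (e c)‖ ^ 2 = q := fun w hw => by
    simp_rw [norm_frameProj_sq hw]
    rw [Finset.sum_comm]
    simp_rw [e.sum_sq_inner_left, hw.1]
    simp
  have hcross : ∑ c, inner ℝ (frameProj v (e c)) (frameProj u (e c))
      = ∑ k, ∑ j, inner ℝ (v j) (u k) ^ 2 := by
    have h1 : ∀ c, inner ℝ (frameProj v (e c)) (frameProj u (e c))
        = ∑ k, ∑ j, inner ℝ (v j) (u k) * (inner ℝ (v j) (e c) * inner ℝ (e c) (u k)) := fun c => by
      rw [inner_frameProj, Finset.sum_comm]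
      refine Finset.sum_congr rfl fun j _ => ?_
      rw [frameProj, inner_sum, Finset.mul_sum]
      refine Finset.sum_congr rfl fun k _ => ?_
      rw [inner_smul_right, real_inner_comm (u k) (e c)]
      ring
    simp_rw [h1]
    rw [Finset.sum_comm]
    refine Finset.sum_congr rfl fun k _ => ?_
    rw [Finset.sum_comm]
    refine Finset.sum_congr rfl fun j _ => ?_
    rw [← Finset.mul_sum, e.sum_inner_mul_inner, sq]
  have hlow : ∀ k, 1 - specNorm (sinTheta v u) ^ 2 ≤ ∑ j, inner ℝ (v j) (u k) ^ 2 := fun k => by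
    have := one_sub_sq_mul_norm_sq_le (v := v) (u := u) (Pi.single k 1)
    simpa [Pi.single_apply, ite_smul] using this
  have hsum := Finset.sum_le_sum fun k (_ : k ∈ Finset.univ) => hlow k
  simp_rw [norm_sub_sq_real]
  rw [Finset.sum_add_distrib, Finset.sum_sub_distrib, ← Finset.mul_sum, hnorm v hv, hnorm u hu,
    hcross]
  simp only [Finset.sum_const, Finset.card_univ, Fintype.card_fin, nsmul_eq_mul] at hsum
  linarith

/-- `‖L W‖_F ≤ ‖L‖ ‖W‖_F` for the matrix `W` with rows `w j`, applied column by column. -/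
lemma sum_norm_sum_smul_sq_le {n p : ℕ} (L : Matrix (Fin n) (Fin n) ℝ)
    (w : Fin n → EuclideanSpace ℝ (Fin p)) :
    ∑ i, ‖∑ j, L i j • w j‖ ^ 2 ≤ specNorm L ^ 2 * ∑ j, ‖w j‖ ^ 2 := by
  simp_rw [EuclideanSpace.norm_sq_eq, Real.norm_eq_abs, sq_abs]
  rw [Finset.sum_comm,
    Finset.sum_comm (s := Finset.univ) (t := Finset.univ) (f := fun j c => w j c ^ 2), Finset.mul_sum]
  refine Finset.sum_le_sum fun c _ => ?_
  have h := pow_le_pow_left₀ (norm_nonneg _)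
    (norm_toEuclideanLin_le L (WithLp.toLp 2 fun j => w j c)) 2
  rw [mul_pow, EuclideanSpace.norm_sq_eq, EuclideanSpace.norm_sq_eq] at h
  simp only [Real.norm_eq_abs, sq_abs] at h
  refine le_trans (le_of_eq (Finset.sum_congr rfl fun i _ => ?_)) h
  simp [Matrix.toLpLin_apply, Matrix.mulVec, dotProduct]

/-! ### The deterministic risk bound -/

/-- Frobenius bound `‖Z (P̂ - P)‖_F² ≤ ‖Z‖² ‖P̂ - P‖_F²` for the noise matrix `Z` with rows `z j`.
Since `P̂ - P` has rank at most `2q`, this pays for a factor `q` and not for the dimension `p`. -/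
lemma sum_norm_frameProj_sub_noise_sq_le {n p q : ℕ} {v u : Fin q → EuclideanSpace ℝ (Fin p)}
    (hv : Orthonormal ℝ v) (hu : Orthonormal ℝ u) (z : Fin n → EuclideanSpace ℝ (Fin p)) :
    ∑ j, ‖frameProj v (z j) - frameProj u (z j)‖ ^ 2
      ≤ ‖rowMap z‖ ^ 2 * (2 * q * specNorm (sinTheta v u) ^ 2) := by
  let e := EuclideanSpace.basisFun (Fin p) ℝ
  calc ∑ j, ‖frameProj v (z j) - frameProj u (z j)‖ ^ 2
      = ∑ c, ‖rowMap z (frameProj v (e c) - frameProj u (e c))‖ ^ 2 := by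
        simp_rw [norm_rowMap_apply_sq, ← inner_frameProj_sub_comm]
        rw [Finset.sum_comm]
        simp_rw [e.sum_sq_inner_left]
    _ ≤ ∑ c, ‖rowMap z‖ ^ 2 * ‖frameProj v (e c) - frameProj u (e c)‖ ^ 2 := by
        gcongr with c
        rw [← mul_pow]
        gcongr
        exact (rowMap z).le_opNorm _
    _ ≤ _ := by
        rw [← Finset.mul_sum]
        gcongr
        exact sum_norm_frameProj_sub_sq_le hv hu e

lemma norm_add_sq_le {E : Type*} [SeminormedAddCommGroup E] (a b : E) :
    ‖a + b‖ ^ 2 ≤ 2 * ‖a‖ ^ 2 + 2 * ‖b‖ ^ 2 := by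
  nlinarith [norm_add_le a b, norm_nonneg (a + b), sq_nonneg (‖a‖ - ‖b‖)]

/-- The deterministic risk bound. By linearity and direction invariance the fitted values are
`L Y P̂`, so the error is minus the oracle error `L Y P - F` minus the rotation error
`L Y (P̂ - P)`. -/
lemma sampleDiscrepancy_twoStep_le {d n p q : ℕ} {u v : Fin q → EuclideanSpace ℝ (Fin p)}
    (hu : Orthonormal ℝ u) (hv : Orthonormal ℝ v) {f : Fin q → (Fin d → ℝ) → ℝ}
    {x : Fin n → Fin d → ℝ} {y z : Fin n → EuclideanSpace ℝ (Fin p)}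
    (hy : ∀ i, y i = combine u f (x i) + z i) {T : SecondStep d n p q} {S : Smoother d n}
    (hTS : IsDirectionInvariant T S) {M : Matrix (Fin n) (Fin n) ℝ}
    (hS : ∀ (Y : Fin n → ℝ) (i : Fin n), S x Y (x i) = M.mulVec Y i) {CL B : ℝ}
    (hM : specNorm M ≤ CL) (hf : ∀ k i, |f k (x i)| ≤ B) (hn : 0 < n) :
    sampleDiscrepancy (combine u f) (twoStep T x y v) x
      ≤ 2 * ∑ k, (1 / (n : ℝ)) * ∑ i, (M.mulVec (fun j => inner ℝ (u k) (y j)) i - f k (x i)) ^ 2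
        + 4 * CL ^ 2 * q * specNorm (sinTheta v u) ^ 2 * (B ^ 2 + 2 * (‖rowMap z‖ ^ 2 / n)) := by
  have hn' : (0 : ℝ) < n := by exact_mod_cast hn
  set s := specNorm (sinTheta v u)
  set O : Fin q → Fin n → ℝ := fun k i =>
    M.mulVec (fun j => inner ℝ (u k) (y j)) i - f k (x i) with hO
  have hfit : ∀ (w : Fin q → EuclideanSpace ℝ (Fin p)) (i : Fin n),
      ∑ k, M.mulVec (fun j => inner ℝ (w k) (y j)) i • w k = ∑ j, M i j • frameProj w (y j) := by
    intro w i
    simp only [Matrix.mulVec, dotProduct, frameProj, Finset.sum_smul, Finset.smul_sum, mul_smul]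
    exact Finset.sum_comm
  have herr : ∀ i, combine u f (x i) - twoStep T x y v (x i)
      = -((∑ k, O k i • u k) + ∑ j, M i j • (frameProj v (y j) - frameProj u (y j))) := by
    intro i
    have h1 : twoStep T x y v (x i) = ∑ j, M i j • frameProj v (y j) := by
      rw [← hfit]
      simp only [twoStep, combine, hTS x y v, hS]
    simp only [h1, hO, sub_smul, Finset.sum_sub_distrib, hfit, smul_sub, combine]
    abel
  have hmain : ∑ i, ‖combine u f (x i) - twoStep T x y v (x i)‖ ^ 2
      ≤ 2 * ∑ k, ∑ i, O k i ^ 2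
        + 2 * (CL ^ 2 * ∑ j, ‖frameProj v (y j) - frameProj u (y j)‖ ^ 2) := by
    have h2 := sum_norm_sum_smul_sq_le M fun j => frameProj v (y j) - frameProj u (y j)
    have h3 : specNorm M ^ 2 ≤ CL ^ 2 := pow_le_pow_left₀ (specNorm_nonneg M) hM 2
    calc ∑ i, ‖combine u f (x i) - twoStep T x y v (x i)‖ ^ 2
        ≤ ∑ i, (2 * ‖∑ k, O k i • u k‖ ^ 2
          + 2 * ‖∑ j, M i j • (frameProj v (y j) - frameProj u (y j))‖ ^ 2) := by
          refine Finset.sum_le_sum fun i _ => ?_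
          rw [herr, norm_neg]
          exact norm_add_sq_le _ _
      _ ≤ _ := by
          rw [Finset.sum_add_distrib, ← Finset.mul_sum, ← Finset.mul_sum, Finset.sum_comm]
          simp_rw [norm_sum_smul_sq hu]
          gcongr
          exact h2.trans (by gcongr)
  -- The signal lies in the span of `u`, so here the operator norm of `P̂ - P` can be used.
  have hsignal : ∀ j, ‖frameProj v (combine u f (x j)) - frameProj u (combine u f (x j))‖ ^ 2
      ≤ s ^ 2 * (q * B ^ 2) := by
    intro j
    refine (norm_frameProj_sub_sq_le hv hu fun k => f k (x j)).trans ?_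
    gcongr
    calc ∑ k, f k (x j) ^ 2 ≤ ∑ _k : Fin q, B ^ 2 :=
          Finset.sum_le_sum fun k _ => sq_le_sq' (abs_le.1 (hf k j)).1 (abs_le.1 (hf k j)).2
      _ = q * B ^ 2 := by simp
  have hrot : ∑ j, ‖frameProj v (y j) - frameProj u (y j)‖ ^ 2
      ≤ 2 * (n * (s ^ 2 * (q * B ^ 2))) + 2 * (‖rowMap z‖ ^ 2 * (2 * q * s ^ 2)) := by
    calc ∑ j, ‖frameProj v (y j) - frameProj u (y j)‖ ^ 2
        ≤ ∑ j, (2 * (s ^ 2 * (q * B ^ 2)) + 2 * ‖frameProj v (z j) - frameProj u (z j)‖ ^ 2) := by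
          refine Finset.sum_le_sum fun j _ => ?_
          rw [hy, frameProj_add, frameProj_add, add_sub_add_comm]
          refine (norm_add_sq_le _ _).trans ?_
          gcongr
          exact hsignal j
      _ ≤ _ := by
          rw [Finset.sum_add_distrib, Finset.sum_const, ← Finset.mul_sum]
          simp only [Finset.card_univ, Fintype.card_fin, nsmul_eq_mul]
          linarith [sum_norm_frameProj_sub_noise_sq_le hv hu z]
  calc sampleDiscrepancy (combine u f) (twoStep T x y v) x
      ≤ (1 / (n : ℝ)) * (2 * ∑ k, ∑ i, O k i ^ 2
        + 2 * (CL ^ 2 * (2 * (n * (s ^ 2 * (q * B ^ 2)))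
          + 2 * (‖rowMap z‖ ^ 2 * (2 * q * s ^ 2))))) := by
        unfold sampleDiscrepancy
        gcongr
        refine hmain.trans ?_
        gcongr
    _ = _ := by
        rw [← Finset.mul_sum]
        field_simp
        ring

/-- Young's inequality at scale `τ`: it replaces the Cauchy–Schwarz inequality for `E s² w`, given
that `s²` has size `τ` and `w` size `1` in mean square. -/
lemma sq_mul_add_le {s w B τ : ℝ} (hτ : 0 < τ) :
    s ^ 2 * (B ^ 2 + 2 * w) ≤ τ / 2 * (B ^ 2 + 2 * w ^ 2 + (B ^ 2 + 2) / τ ^ 2 * s ^ 4) := by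
  set t := s ^ 2 / τ with ht
  have hs : s ^ 2 = τ * t := by rw [ht]; field_simp
  have h4 : (B ^ 2 + 2) / τ ^ 2 * s ^ 4 = (B ^ 2 + 2) * t ^ 2 := by rw [ht]; field_simp
  rw [h4, hs]
  have h1 : t * (B ^ 2 + 2 * w) ≤ 1 / 2 * (B ^ 2 + 2 * w ^ 2 + (B ^ 2 + 2) * t ^ 2) := by
    nlinarith [sq_nonneg (t - w), mul_nonneg (sq_nonneg B) (sq_nonneg (t - 1))]
  nlinarith

/-- A bound for `E (‖Z‖² / n)²`, where `Z` is the `n × p` noise matrix and `p ≤ A n`. -/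
noncomputable def noiseConst (σ A : ℝ) : ℝ :=
  (36 * (σ ^ 2 + 1)) ^ 2 * (8 * (1 + |A|) ^ 2 + 4)

/-! ### Probabilistic estimates in the model -/

section
variable {Ω : Type*} [MeasurableSpace Ω] {d n p q : ℕ} {P : Measure Ω} [IsProbabilityMeasure P]
  {σ : ℝ} {u : Fin q → EuclideanSpace ℝ (Fin p)} {f : Fin q → (Fin d → ℝ) → ℝ}
  {x : Fin n → Ω → Fin d → ℝ} {z : Fin n → Ω → EuclideanSpace ℝ (Fin p)}

lemma IsModel.hasLaw_design (h : IsModel P σ u f x z) :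
    HasLaw (fun ω i => x i ω) (designLaw d n) P where
  aemeasurable := aemeasurable_pi_lambda _ fun i => (h.design_law i).aemeasurable
  map_eq := by
    rw [(iIndepFun_iff_map_fun_eq_pi_map fun i => (h.design_law i).aemeasurable).1 h.design_indep]
    simp_rw [(h.design_law _).map_eq]
    rfl

lemma IsModel.hasLaw_noise (h : IsModel P σ u f x z) :
    HasLaw (fun ω i => z i ω) (Measure.pi fun _ : Fin n => multivariateGaussian
      (0 : EuclideanSpace ℝ (Fin p)) (σ ^ 2 • (1 : Matrix (Fin p) (Fin p) ℝ))) P where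
  aemeasurable := aemeasurable_pi_lambda _ fun i => (h.noise_law i).aemeasurable
  map_eq := by
    rw [(iIndepFun_iff_map_fun_eq_pi_map fun i => (h.noise_law i).aemeasurable).1 h.noise_indep]
    simp_rw [(h.noise_law _).map_eq]

lemma IsModel.expect_opNorm_noise_le (h : IsModel P σ u f x z) (hn : 0 < n) {A : ℝ}
    (hA : (p : ℝ) ≤ A * n) :
    expect P (fun ω => (‖rowMap fun i => z i ω‖ ^ 2 / n) ^ 2) ≤ ENNReal.ofReal (noiseConst σ A) := by
  have hn' : (0 : ℝ) < n := by exact_mod_cast hn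
  have hn1 : (1 : ℝ) ≤ n := by exact_mod_cast hn
  set c : ℝ := 1 / (9 * (σ ^ 2 + 1)) with hc
  have hcpos : 0 < c := by positivity
  have hcσ : c * σ ^ 2 ≤ 4 / 25 := by
    rw [hc, one_div_mul_eq_div, div_le_div_iff₀ (by positivity) (by norm_num)]
    nlinarith [sq_nonneg σ]
  have hmeas : Measurable fun z : Fin n → EuclideanSpace ℝ (Fin p) =>
      ENNReal.ofReal ((c * ‖rowMap z‖ ^ 2 / 4) ^ 2) :=
    (ENNReal.continuous_ofReal.comp
      (((continuous_const.mul (continuous_rowMap.norm.pow 2)).div_const 4).pow 2)).measurable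
  have hbound := lintegral_opNorm_rowMap_pow_four_le (n := n) (p := p) σ hcpos.le hcσ
  rw [← h.hasLaw_noise.lintegral_comp hmeas.aemeasurable] at hbound
  have hscale : ∀ ω, ENNReal.ofReal ((‖rowMap fun i => z i ω‖ ^ 2 / n) ^ 2)
      = ENNReal.ofReal ((4 / (c * n)) ^ 2)
        * ENNReal.ofReal ((c * ‖rowMap fun i => z i ω‖ ^ 2 / 4) ^ 2) := fun ω => by
    rw [← ENNReal.ofReal_mul (by positivity)]
    congr 1
    field_simp
  unfold expect
  simp_rw [hscale]
  rw [lintegral_const_mul' _ _ ENNReal.ofReal_ne_top]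
  refine (mul_le_mul_right hbound _).trans ?_
  rw [← ENNReal.ofReal_mul (by positivity)]
  refine ENNReal.ofReal_le_ofReal ?_
  have h1 : (4 / (c * n)) ^ 2 = (36 * (σ ^ 2 + 1)) ^ 2 / n ^ 2 := by
    rw [hc]; field_simp; norm_num
  have h2 : 8 * ((n : ℝ) + p) ^ 2 + 4 ≤ (8 * (1 + |A|) ^ 2 + 4) * n ^ 2 := by
    have hp : (n : ℝ) + p ≤ (1 + |A|) * n := by nlinarith [le_abs_self A]
    have := pow_le_pow_left₀ (by positivity) hp 2
    nlinarith
  calc (4 / (c * n)) ^ 2 * (8 * ((n : ℝ) + p) ^ 2 + 4)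
      ≤ (36 * (σ ^ 2 + 1)) ^ 2 / n ^ 2 * ((8 * (1 + |A|) ^ 2 + 4) * n ^ 2) := by
        rw [h1]; gcongr
    _ = noiseConst σ A := by unfold noiseConst; field_simp

/-- Measurability of the oracle error. The remaining terms of the risk bound are constant, or
measurable functions of the noise, or left as the last summand of the integral, so that no
measurability of the principal angles is needed. -/
lemma IsModel.aemeasurable_oracleError (h : IsModel P σ u f x z)
    {L : (Fin n → Fin d → ℝ) → Matrix (Fin n) (Fin n) ℝ}
    (hL : ∀ i j, AEMeasurable (fun t => L t i j) (designLaw d n)) (k : Fin q) :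
    AEMeasurable (fun ω => (1 / (n : ℝ)) * ∑ i,
      ((L fun j => x j ω).mulVec (fun j => inner ℝ (u k) (response u f x z ω j)) i
        - f k (x i ω)) ^ 2) P := by
  have hfx : ∀ k i, AEMeasurable (fun ω => f k (x i ω)) P := fun k i => by
    refine AEMeasurable.comp_aemeasurable (g := f k) ?_ (h.design_law i).aemeasurable
    rw [(h.design_law i).map_eq]
    exact (h.memLp k).1.aemeasurable
  have hLx : ∀ i j, AEMeasurable (fun ω => L (fun m => x m ω) i j) P := fun i j => by
    refine AEMeasurable.comp_aemeasurable (g := fun t => L t i j) ?_ h.hasLaw_design.aemeasurable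
    rw [h.hasLaw_design.map_eq]
    exact hL i j
  have hy : ∀ j, AEMeasurable (fun ω => response u f x z ω j) P := fun j => by
    refine AEMeasurable.add ?_ (h.noise_law j).aemeasurable
    exact Finset.aemeasurable_fun_sum _ fun k _ => (hfx k j).smul_const _
  refine AEMeasurable.const_mul (Finset.aemeasurable_fun_sum _ fun i _ => ?_) _
  refine AEMeasurable.pow_const (AEMeasurable.sub ?_ (hfx k i)) 2
  change AEMeasurable (fun ω => ∑ j, L (fun m => x m ω) i j
    * inner ℝ (u k) (response u f x z ω j)) P
  exact Finset.aemeasurable_fun_sum _ fun j _ =>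
    (hLx i j).mul (AEMeasurable.inner aemeasurable_const (hy j))

/-- The constant in the bound for the risk of the two-step estimator; absolute values are taken
because the given constants may be negative. -/
noncomputable def riskConst (σ Csin CL Crate A B : ℝ) : ℝ :=
  2 * |Crate| + 2 * CL ^ 2 * (B ^ 2 + 2 * noiseConst σ A + (B ^ 2 + 2) * |Csin|)

lemma noiseConst_nonneg (σ A : ℝ) : 0 ≤ noiseConst σ A := by unfold noiseConst; positivity

lemma riskConst_nonneg (σ Csin CL Crate A B : ℝ) : 0 ≤ riskConst σ Csin CL Crate A B := by
  have := noiseConst_nonneg σ A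
  unfold riskConst; positivity

/-- The risk bound, in the form `K q max {n⁻ʳ, p / n}`. -/
lemma expect_sampleDiscrepancy_twoStep_le {Csin CL Crate A B r : ℝ}
    {uhat : Ω → Fin q → EuclideanSpace ℝ (Fin p)} {T : SecondStep d n p q} {S : Smoother d n}
    {L : (Fin n → Fin d → ℝ) → Matrix (Fin n) (Fin n) ℝ} (hn : 0 < n)
    (h : IsModel P σ u f x z) (hf : ∀ k, ∀ᵐ t ∂(unifCube d), |f k t| ≤ B) (hA : (p : ℝ) ≤ A * n)
    (huhat : ∀ᵐ ω ∂P, Orthonormal ℝ (uhat ω))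
    (hsin : expect P (fun ω => specNorm (sinTheta (uhat ω) u) ^ 4)
      ≤ ENNReal.ofReal (Csin * ((p : ℝ) / n) ^ 2))
    (hTS : IsDirectionInvariant T S) (hS : IsLinearSmoother S L)
    (hL : ∀ᵐ t ∂(designLaw d n), specNorm (L t) ≤ CL) (hrate : AttainsRate P u f x z L Crate r) :
    expect P (fun ω => sampleDiscrepancy (combine u f)
        (twoStep T (fun i => x i ω) (response u f x z ω) (uhat ω)) (fun i => x i ω))
      ≤ ENNReal.ofReal (riskConst σ Csin CL Crate A B * (q * max ((n : ℝ) ^ (-r)) (p / n))) := by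
  have hn' : (0 : ℝ) < n := by exact_mod_cast hn
  rcases Nat.eq_zero_or_pos p with rfl | hp
  · have h0 : ∀ ω, sampleDiscrepancy (combine u f)
        (twoStep T (fun i => x i ω) (response u f x z ω) (uhat ω)) (fun i => x i ω) = 0 :=
      fun ω => by
      simp [sampleDiscrepancy, Subsingleton.elim _ (0 : EuclideanSpace ℝ (Fin 0))]
    simp [expect, h0]
  -- From here on `p / n` is positive and may serve as the scale in Young's inequality.
  have hp' : (0 : ℝ) < p := by exact_mod_cast hp
  set τ : ℝ := p / n with hτ
  have hτ0 : 0 < τ := by positivity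
  set O : Fin q → Ω → ℝ := fun k ω => (1 / (n : ℝ)) * ∑ i,
      ((L fun j => x j ω).mulVec (fun j => inner ℝ (u k) (response u f x z ω j)) i
        - f k (x i ω)) ^ 2 with hO
  have hO0 : ∀ k ω, 0 ≤ O k ω := fun k ω => by simp only [hO]; positivity
  set W : Ω → ℝ := fun ω => (‖rowMap fun i => z i ω‖ ^ 2 / n) ^ 2 with hW
  have hW0 : ∀ ω, 0 ≤ W ω := fun ω => sq_nonneg _
  set s : Ω → ℝ := fun ω => specNorm (sinTheta (uhat ω) u) with hs
  set κ : ℝ := 2 * CL ^ 2 * q * τ with hκ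
  have hκ0 : 0 ≤ κ := by positivity
  have hfx : ∀ᵐ ω ∂P, ∀ k i, |f k (x i ω)| ≤ B := by
    rw [ae_all_iff]; intro k
    rw [ae_all_iff]; intro i
    refine ae_of_ae_map (h.design_law i).aemeasurable (p := fun t => |f k t| ≤ B) ?_
    rw [(h.design_law i).map_eq]
    exact hf k
  have hdesign : ∀ᵐ ω ∂P, specNorm (L fun i => x i ω) ≤ CL ∧
      ∀ (Y : Fin n → ℝ) (i : Fin n),
        S (fun i => x i ω) Y (x i ω) = (L fun i => x i ω).mulVec Y i := by
    refine ae_of_ae_map h.hasLaw_design.aemeasurable (p := fun t => specNorm (L t) ≤ CL ∧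
      ∀ (Y : Fin n → ℝ) (i : Fin n), S t Y (t i) = (L t).mulVec Y i) ?_
    rw [h.hasLaw_design.map_eq]
    exact hL.and hS.fitted
  have hpoint : ∀ᵐ ω ∂P, sampleDiscrepancy (combine u f)
        (twoStep T (fun i => x i ω) (response u f x z ω) (uhat ω)) (fun i => x i ω)
      ≤ (κ * B ^ 2 + 2 * ∑ k, O k ω + 2 * κ * W ω) + κ * ((B ^ 2 + 2) / τ ^ 2) * s ω ^ 4 := by
    filter_upwards [hfx, hdesign, huhat] with ω h1 h2 h3
    refine (sampleDiscrepancy_twoStep_le (y := response u f x z ω) (z := fun i => z i ω)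
      h.orthonormal h3 (fun i => rfl) hTS h2.2 h2.1 h1 hn).trans ?_
    change 2 * ∑ k, O k ω + 4 * CL ^ 2 * q * s ω ^ 2
      * (B ^ 2 + 2 * (‖rowMap fun i => z i ω‖ ^ 2 / n)) ≤ _
    have := mul_le_mul_of_nonneg_left (sq_mul_add_le (s := s ω)
      (w := ‖rowMap fun i => z i ω‖ ^ 2 / n) (B := B) hτ0)
      (show (0 : ℝ) ≤ 4 * CL ^ 2 * q by positivity)
    simp only [hW, hκ]
    linarith
  have hintO : ∫⁻ ω, ENNReal.ofReal (∑ k, O k ω) ∂P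
      ≤ ENNReal.ofReal (q * (|Crate| * (n : ℝ) ^ (-r))) := by
    have hk : ∀ k, ∫⁻ ω, ENNReal.ofReal (O k ω) ∂P ≤ ENNReal.ofReal (|Crate| * (n : ℝ) ^ (-r)) :=
      fun k => (hrate k).trans (ENNReal.ofReal_le_ofReal (by gcongr; exact le_abs_self _))
    simp_rw [ENNReal.ofReal_sum_of_nonneg fun k (_ : k ∈ Finset.univ) => hO0 k _]
    rw [lintegral_finsetSum' _ fun k _ =>
      (h.aemeasurable_oracleError hS.aemeasurable k).ennreal_ofReal]
    refine (Finset.sum_le_sum fun k _ => hk k).trans (le_of_eq ?_)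
    rw [ENNReal.ofReal_mul (by positivity)]
    simp
  have hintW : ∫⁻ ω, ENNReal.ofReal (W ω) ∂P ≤ ENNReal.ofReal (noiseConst σ A) :=
    h.expect_opNorm_noise_le hn hA
  have hints : ∫⁻ ω, ENNReal.ofReal (s ω ^ 4) ∂P ≤ ENNReal.ofReal (|Csin| * τ ^ 2) :=
    hsin.trans (ENNReal.ofReal_le_ofReal (by gcongr; exact le_abs_self _))
  have hOm : AEMeasurable (fun ω => ENNReal.ofReal (∑ k, O k ω)) P :=
    (Finset.aemeasurable_fun_sum _ fun k _ =>
      h.aemeasurable_oracleError hS.aemeasurable k).ennreal_ofReal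
  have hWm : AEMeasurable (fun ω => ENNReal.ofReal (W ω)) P := by
    refine AEMeasurable.ennreal_ofReal ?_
    refine (((continuous_rowMap.norm.pow 2).div_const (n : ℝ)).pow 2).measurable.comp_aemeasurable
      (h.hasLaw_noise.aemeasurable)
  have hN := noiseConst_nonneg σ A
  have hnr : (0 : ℝ) ≤ (n : ℝ) ^ (-r) := by positivity
  unfold expect
  calc _ ≤ ∫⁻ ω, (((ENNReal.ofReal (κ * B ^ 2) + ENNReal.ofReal 2 * ENNReal.ofReal (∑ k, O k ω))
          + ENNReal.ofReal (2 * κ) * ENNReal.ofReal (W ω))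
          + ENNReal.ofReal (κ * ((B ^ 2 + 2) / τ ^ 2)) * ENNReal.ofReal (s ω ^ 4)) ∂P := by
        refine lintegral_mono_ae (hpoint.mono fun ω hω => ?_)
        have hsum : 0 ≤ ∑ k, O k ω := Finset.sum_nonneg fun k _ => hO0 k ω
        have := hW0 ω
        refine (ENNReal.ofReal_le_ofReal hω).trans (le_of_eq ?_)
        rw [ENNReal.ofReal_add (by positivity) (by positivity),
          ENNReal.ofReal_add (by positivity) (by positivity),
          ENNReal.ofReal_add (by positivity) (by positivity),
          ENNReal.ofReal_mul (by positivity : (0 : ℝ) ≤ 2),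
          ENNReal.ofReal_mul (by positivity : (0 : ℝ) ≤ 2 * κ),
          ENNReal.ofReal_mul (by positivity : (0 : ℝ) ≤ κ * ((B ^ 2 + 2) / τ ^ 2))]
    _ = ((ENNReal.ofReal (κ * B ^ 2) + ENNReal.ofReal 2 * ∫⁻ ω, ENNReal.ofReal (∑ k, O k ω) ∂P)
          + ENNReal.ofReal (2 * κ) * ∫⁻ ω, ENNReal.ofReal (W ω) ∂P)
          + ENNReal.ofReal (κ * ((B ^ 2 + 2) / τ ^ 2)) * ∫⁻ ω, ENNReal.ofReal (s ω ^ 4) ∂P := by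
        have hm₁ : AEMeasurable (fun ω => ENNReal.ofReal (κ * B ^ 2)
            + ENNReal.ofReal 2 * ENNReal.ofReal (∑ k, O k ω)) P :=
          aemeasurable_const.add (hOm.const_mul _)
        have hm₂ : AEMeasurable (fun ω => (ENNReal.ofReal (κ * B ^ 2)
            + ENNReal.ofReal 2 * ENNReal.ofReal (∑ k, O k ω))
            + ENNReal.ofReal (2 * κ) * ENNReal.ofReal (W ω)) P :=
          hm₁.add (hWm.const_mul _)
        rw [lintegral_add_left' hm₂, lintegral_add_left' hm₁,
          lintegral_add_left' aemeasurable_const, lintegral_const_mul' _ _ ENNReal.ofReal_ne_top,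
          lintegral_const_mul' _ _ ENNReal.ofReal_ne_top,
          lintegral_const_mul' _ _ ENNReal.ofReal_ne_top, lintegral_const, measure_univ, mul_one]
    _ ≤ ((ENNReal.ofReal (κ * B ^ 2)
            + ENNReal.ofReal 2 * ENNReal.ofReal (q * (|Crate| * (n : ℝ) ^ (-r))))
          + ENNReal.ofReal (2 * κ) * ENNReal.ofReal (noiseConst σ A))
          + ENNReal.ofReal (κ * ((B ^ 2 + 2) / τ ^ 2)) * ENNReal.ofReal (|Csin| * τ ^ 2) := by
        gcongr
    _ = ENNReal.ofReal (κ * B ^ 2 + 2 * (q * (|Crate| * (n : ℝ) ^ (-r))) + 2 * κ * noiseConst σ A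
          + κ * ((B ^ 2 + 2) / τ ^ 2) * (|Csin| * τ ^ 2)) := by
        rw [ENNReal.ofReal_add (by positivity) (by positivity),
          ENNReal.ofReal_add (by positivity) (by positivity),
          ENNReal.ofReal_add (by positivity) (by positivity),
          ENNReal.ofReal_mul (q := q * (|Crate| * (n : ℝ) ^ (-r))) (by positivity : (0 : ℝ) ≤ 2),
          ENNReal.ofReal_mul (by positivity : (0 : ℝ) ≤ 2 * κ),
          ENNReal.ofReal_mul (by positivity : (0 : ℝ) ≤ κ * ((B ^ 2 + 2) / τ ^ 2))]
    _ ≤ _ := by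
        refine ENNReal.ofReal_le_ofReal ?_
        set m := max ((n : ℝ) ^ (-r)) τ
        have hm1 : (n : ℝ) ^ (-r) ≤ m := le_max_left _ _
        have hm2 : τ ≤ m := le_max_right _ _
        calc _ = 2 * |Crate| * (q * (n : ℝ) ^ (-r))
              + 2 * CL ^ 2 * (B ^ 2 + 2 * noiseConst σ A + (B ^ 2 + 2) * |Csin|) * (q * τ) := by
              rw [hκ]; field_simp; ring
          _ ≤ 2 * |Crate| * (q * m)
              + 2 * CL ^ 2 * (B ^ 2 + 2 * noiseConst σ A + (B ^ 2 + 2) * |Csin|) * (q * m) := by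
              gcongr
          _ = _ := by unfold riskConst; ring

end

end PSR

theorem theorem1 (σ Csin CL Crate A B : ℝ) :
    ∃ (K : ℝ) (K' : ℝ → ℝ),
      ∀ (d n p q : ℕ) (r : ℝ) (Ω : Type*) [MeasurableSpace Ω] (P : Measure Ω)
        [IsProbabilityMeasure P]
        (u : Fin q → EuclideanSpace ℝ (Fin p)) (f : Fin q → (Fin d → ℝ) → ℝ)
        (x : Fin n → Ω → Fin d → ℝ) (z : Fin n → Ω → EuclideanSpace ℝ (Fin p))
        (uhat : Ω → Fin q → EuclideanSpace ℝ (Fin p))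
        (T : PSR.SecondStep d n p q) (S : PSR.Smoother d n)
        (L : (Fin n → Fin d → ℝ) → Matrix (Fin n) (Fin n) ℝ),
        0 < n →
        PSR.IsModel P σ u f x z →
        (∀ k, ∀ᵐ t ∂(PSR.unifCube d), |f k t| ≤ B) →
        (p : ℝ) ≤ A * n →
        AEMeasurable uhat P →
        (∀ᵐ ω ∂P, Orthonormal ℝ (uhat ω)) →
        PSR.expect P (fun ω => PSR.specNorm (PSR.sinTheta (uhat ω) u) ^ 4)
          ≤ ENNReal.ofReal (Csin * ((p : ℝ) / n) ^ 2) →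
        PSR.IsDirectionInvariant T S →
        PSR.IsLinearSmoother S L →
        (∀ᵐ t ∂(PSR.designLaw d n), PSR.specNorm (L t) ≤ CL) →
        PSR.AttainsRate P u f x z L Crate r →
        PSR.expect P (fun ω => PSR.sampleDiscrepancy (PSR.combine u f)
            (PSR.twoStep T (fun i => x i ω) (PSR.response u f x z ω) (uhat ω)) (fun i => x i ω))
          ≤ ENNReal.ofReal (K * (q * (n : ℝ) ^ (-r) * max 1 (p * (n : ℝ) ^ (-(1 - r))))) ∧
        ∀ A' : ℝ, (p : ℝ) ≤ A' * (n : ℝ) ^ (1 - r) →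
          PSR.expect P (fun ω => PSR.sampleDiscrepancy (PSR.combine u f)
              (PSR.twoStep T (fun i => x i ω) (PSR.response u f x z ω) (uhat ω)) (fun i => x i ω))
            ≤ ENNReal.ofReal (K' A' * (q * (n : ℝ) ^ (-r))) := by
  refine ⟨PSR.riskConst σ Csin CL Crate A B,
    fun A' => PSR.riskConst σ Csin CL Crate A B * max 1 A', ?_⟩
  intro d n p q r Ω _ P _ u f x z uhat T S L hn hmodel hf hA _ huhat hsin hTS hS hL hrate
  have hn' : (0 : ℝ) < n := by exact_mod_cast hn
  have hK := PSR.riskConst_nonneg σ Csin CL Crate A B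
  have hrisk := PSR.expect_sampleDiscrepancy_twoStep_le hn hmodel hf hA huhat hsin hTS hS hL hrate
  have hmax : max ((n : ℝ) ^ (-r)) (p / n)
      = (n : ℝ) ^ (-r) * max 1 (p * (n : ℝ) ^ (-(1 - r))) := by
    rw [mul_max_of_nonneg _ _ (by positivity), mul_one]
    congr 1
    rw [mul_left_comm, ← Real.rpow_add hn', show -r + -(1 - r) = -1 by ring, Real.rpow_neg_one,
      div_eq_mul_inv]
  rw [hmax, ← mul_assoc (q : ℝ)] at hrisk
  refine ⟨hrisk, fun A' hA' => hrisk.trans (ENNReal.ofReal_le_ofReal ?_)⟩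
  have hp : p * (n : ℝ) ^ (-(1 - r)) ≤ A' := by
    rwa [Real.rpow_neg hn'.le, ← div_eq_mul_inv, div_le_iff₀ (by positivity)]
  calc _ ≤ PSR.riskConst σ Csin CL Crate A B * (q * (n : ℝ) ^ (-r) * max 1 A') := by gcongr
    _ = _ := by ring
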